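/- Let $p$ be a prime, let $A$ be a Henselian valuation ring (of arbitrary rank) that is not a field, and let $K$ be its field of fractions, assumed to have characteristic $p$. Let $L/K$ be a nontrivial Artin–Schreier extension, i.e. $L=K(\alpha)\neq K$ with $\alpha^p-\alpha\in K$; let $B$ be the integral closure of $A$ in $L$, and let $\sigma$ be a generator of $\mathrm{Gal}(L/K)$. Let $\mathscr{H}\subseteq K$ be the $A$-submodule generated by all $1/h$, where $h$ runs through the elements of $K^\times$ such that the solutions of $T^p-T=h$ generate $L/K$. Let $\mathcal{J}_\sigma\subseteq L$ be the $B$-submodule generated by all $\frac{\sigma(b)}{b}-1$ with $b\in L^\times$. Then $\mathscr{H}$ is an ideal of $A$ (that is, $\mathscr{H}\subseteq A$), $\mathcal{J}_\sigma$ is an ideal of $B$ (that is, $\mathcal{J}_\sigma\subseteq B$), and $$\mathscr{H}=\bigl(N_{L/K}(\mathcal{J}_\sigma)\bigr),$$ where the right-hand side is the ideal of $A$ generated by the norms $N_{L/K}(x)$ of all $x\in\mathcal{J}_\sigma$. No assumption is made on the rank of the valuation or on the defect of $L/K$. -/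

import Mathlib

open scoped IntermediateField

/-- `h : K` generates `L/K` as an Artin–Schreier extension: `L = K(α)` for a solution `α` of
`T ^ p - T = h`. (In characteristic `p` all solutions are then `α + i` with `i` in the prime field,
so it does not matter which solution is adjoined.) -/
def ArtinSchreierGenerates (p : ℕ) (K L : Type*) [Field K] [Field L] [Algebra K L] (h : K) :
    Prop :=
  ∃ α : L, α ^ p - α = algebraMap K L h ∧ K⟮α⟯ = ⊤

/-- `L/K` is a nontrivial Artin–Schreier extension (used for `K` of characteristic `p`). -/
def IsNontrivialArtinSchreier (p : ℕ) (K L : Type*) [Field K] [Field L] [Algebra K L] : Prop :=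
  (∃ f : K, ArtinSchreierGenerates p K L f) ∧ (⊥ : IntermediateField K L) ≠ ⊤

/-- The `A`-submodule of `K` generated by all `1 / h`, where `h` runs through the nonzero elements
of `K` such that the solutions of `T ^ p - T = h` generate `L/K`. -/
def artinSchreierIdeal (p : ℕ) (A K L : Type*) [CommRing A] [Field K] [Algebra A K] [Field L]
    [Algebra K L] : Submodule A K :=
  Submodule.span A {x : K | ∃ h : K, h ≠ 0 ∧ ArtinSchreierGenerates p K L h ∧ x = 1 / h}

/-- The `B`-submodule of `L` generated by all `σ b / b - 1`, `b ∈ L` nonzero, where `B` is the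
integral closure of `A` in `L`. -/
def lefschetzIdeal (A : Type*) {K L : Type*} [CommRing A] [Field K] [Field L] [Algebra K L]
    [Algebra A L] (σ : L ≃ₐ[K] L) : Submodule (integralClosure A L) L :=
  Submodule.span (integralClosure A L) {x : L | ∃ b : L, b ≠ 0 ∧ x = σ b / b - 1}

/-- The `A`-submodule of `K` generated by the norms `N_{L/K}(x)` of all elements `x` of `J`. -/
noncomputable def normIdeal (A K : Type*) {L : Type*} [CommRing A] [Field K] [Algebra A K]
    [Field L] [Algebra K L] [Algebra A L] (J : Submodule (integralClosure A L) L) :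
    Submodule A K :=
  Submodule.span A {x : K | ∃ y ∈ J, x = Algebra.norm K y}

/-! The valuation of A extends to a Galois-invariant valuation v on the separable closure Ω of K,
whose valuation ring consists of the integral elements (`isIntegral_or_isIntegral_inv`,
`valuation_algEquiv`). Fix a generator α with α^p − α = f. Its translates α − k, k ∈ K, are again
Artin–Schreier generators, of norm f − (k^p − k).

One inclusion is direct: a generator β for h satisfies σβ = β + i with i ≠ 0 in the prime field, so
β⁻¹ = i⁻¹(σβ/β − 1) lies in J_σ and has norm 1/h.

For the other, every y ∈ J_σ satisfies v(y(α − k)) ≤ 1 for some k; then y(α − k) is integral, and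
taking norms puts N(y) in A · 1/(f − (k^p − k)). To find k, write b = g(α) with deg g < p. Then g
splits in Ω and σb/b = ∏ (1 + i/(α − r)) over its roots r. Averaging the conjugates of r gives k ∈ K
with v(α − k) ≤ v(α − r) (`exists_valuation_sub_algebraMap_le`). Hensel's lemma gives v(α − k) ≥ 1
for all k, which controls the expanded product and places J_σ in B. The distances v(α − k) need not
attain a minimum, so defect plays no role. -/

/-! ### Integral closures of a Henselian valuation ring are valuation rings. -/

open Polynomial in
open scoped Pointwise in
-- Given maximal ideals M ≠ M', conjugate because both lie over the maximal ideal of A, a product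
-- over the decomposition group of M yields y ≡ 1 mod M lying in all other conjugates of M. The
-- orbit polynomial of y has 1 as a simple root modulo the maximal ideal of A; lifting that root
-- forces y ∈ A, and an element of A cannot separate M from M'.
theorem isLocalRing_of_isInvariant (A B G : Type*) [CommRing A] [HenselianLocalRing A]
    [CommRing B] [IsDomain B] [Algebra A B] [Group G] [Finite G] [MulSemiringAction G B]
    [SMulCommClass G A B] [Algebra.IsInvariant A B G] : IsLocalRing B := by
  classical
  cases nonempty_fintype G
  have hint : Algebra.IsIntegral A B := Algebra.IsInvariant.isIntegral A B G
  have hunder (M : Ideal B) [M.IsMaximal] : M.under A = IsLocalRing.maximalIdeal A :=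
    IsLocalRing.eq_maximalIdeal (Ideal.isMaximal_comap_of_isIntegral_of_isMaximal M)
  refine IsLocalRing.of_unique_max_ideal ?_
  obtain ⟨M, hM⟩ := Ideal.exists_maximal B
  refine ⟨M, hM, fun M' hM' ↦ ?_⟩
  have hM' : M'.IsMaximal := hM'
  by_contra hne
  have hMunder := hunder M
  let I : MulAction.orbit G M → Ideal B := Subtype.val
  have hImax (i) : (I i).IsMaximal := by
    obtain ⟨_, g, rfl⟩ := i
    exact Ideal.map_isMaximal_of_equiv (MulSemiringAction.toRingEquiv G B g)
  have : Finite (MulAction.orbit G M) := Set.finite_range _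
  obtain ⟨x, hx⟩ := Ideal.exists_forall_sub_mem_ideal (I := I)
    (fun i j hij ↦ Ideal.isCoprime_of_isMaximal (fun h ↦ hij (Subtype.ext h)))
    (fun i ↦ if (i : Ideal B) = M then 1 else 0)
  have hx1 : x - 1 ∈ M := by simpa [I] using hx ⟨M, MulAction.mem_orbit_self M⟩
  have hx0 (g : G) (hg : g • M ≠ M) : x ∈ g • M := by
    simpa [I, hg] using hx ⟨g • M, g, rfl⟩
  let D := MulAction.stabilizer G M
  let y : B := ∏ g : D, (g : G) • x
  have hy1 : y - 1 ∈ M := by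
    rw [← Ideal.Quotient.eq_zero_iff_mem, map_sub, map_one, sub_eq_zero, map_prod]
    refine Finset.prod_eq_one fun g _ ↦ ?_
    rw [← sub_eq_zero, ← map_one (Ideal.Quotient.mk M), ← map_sub, Ideal.Quotient.eq_zero_iff_mem]
    have : (g : G) • (x - 1) ∈ (g : G) • M := Ideal.smul_mem_pointwise_smul _ _ _ hx1
    rwa [g.2, smul_sub, smul_one] at this
  have hy0 (g : G) (hg : g • M ≠ M) : y ∈ g • M := by
    refine Ideal.mem_of_dvd _ (Finset.dvd_prod_of_mem _ (Finset.mem_univ (1 : D))) ?_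
    simpa using hx0 g hg
  have hyD (g : G) (hg : g • M = M) : g • y = y := by
    simp only [y, Finset.smul_prod', smul_smul]
    exact Fintype.prod_equiv (Equiv.mulLeft (⟨g, hg⟩ : D)) _ _ fun _ ↦ rfl
  have hyconj (g : G) (hg : g • y ≠ y) : g • y ∈ M := by
    have h : g⁻¹ • M ≠ M := fun h ↦ hg (hyD g (by
      conv_lhs => rw [← h]
      simp))
    simpa using Ideal.smul_mem_pointwise_smul g _ _ (hy0 _ h)
  obtain ⟨f, hf, -, hfm⟩ := lifts_and_natDegree_eq_and_monic
    (f := algebraMap A B) (p := prodXSubSMul G B y)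
    ((lifts_iff_coeff_lifts _).2 fun n ↦
      Algebra.IsInvariant.isInvariant (G := G) _ fun g ↦ prodXSubSMul.coeff G B y g n)
    (prodXSubSMul.monic G B y)
  let Q : B[X] := ∏ g ∈ (Finset.univ : Finset (G ⧸ MulAction.stabilizer G y)).erase
    (QuotientGroup.mk 1), (X - C (MulAction.ofQuotientStabilizer G y g))
  have hQ : prodXSubSMul G B y = (X - C y) * Q := by
    rw [prodXSubSMul, ← Finset.mul_prod_erase _ _ (Finset.mem_univ (QuotientGroup.mk 1))]
    simp [Q]
  have hQ1 : Q.eval 1 - 1 ∈ M := by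
    rw [← Ideal.Quotient.eq_zero_iff_mem, map_sub, map_one, sub_eq_zero, eval_prod, map_prod]
    refine Finset.prod_eq_one fun g hg ↦ ?_
    induction g using QuotientGroup.induction_on with | H g => ?_
    have hg : g • y ≠ y := fun h ↦ (Finset.mem_erase.1 hg).1 (by
      rw [eq_comm, QuotientGroup.eq]; simpa using h)
    simpa [Ideal.Quotient.eq_zero_iff_mem] using hyconj g hg
  have hmem (a : A) : algebraMap A B a ∈ M ↔ a ∈ IsLocalRing.maximalIdeal A := by
    rw [← hMunder]; rfl
  have heval (q : A[X]) (a : A) : (q.map (algebraMap A B)).eval (algebraMap A B a) =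
      algebraMap A B (q.eval a) := by
    rw [eval_map_algebraMap, aeval_algebraMap_apply_eq_algebraMap_eval]
  have h1 : f.eval 1 ∈ IsLocalRing.maximalIdeal A := by
    rw [← hmem, ← heval, map_one, hf, hQ, eval_mul]
    refine M.mul_mem_right _ ?_
    simpa using M.neg_mem hy1
  have h1' : IsUnit (f.derivative.eval 1) := by
    rw [← IsLocalRing.notMem_maximalIdeal, ← hmem, ← heval, map_one, ← derivative_map, hf, hQ]
    intro h
    refine hM.ne_top ((Ideal.eq_top_iff_one _).2 ?_)
    have h' : (1 - y) * Q.derivative.eval 1 ∈ M :=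
      M.mul_mem_right _ (by simpa using M.neg_mem hy1)
    have := M.sub_mem (M.sub_mem h h') hQ1
    simpa [derivative_mul] using this
  obtain ⟨a, ha, ha1⟩ := HenselianLocalRing.is_henselian f hfm 1 h1 h1'
  -- B is a domain, so the root a is some conjugate g • y, and g fixes the image of A.
  have hya : y = algebraMap A B a := by
    have h : (prodXSubSMul G B y).eval (algebraMap A B a) = 0 := by
      rw [← hf, heval, ha, map_zero]
    simp only [prodXSubSMul, eval_prod, Finset.prod_eq_zero_iff] at h
    obtain ⟨g, -, hg⟩ := h
    induction g using QuotientGroup.induction_on with | H g => ?_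
    replace hg : algebraMap A B a = g • y := by simpa [sub_eq_zero] using hg
    rw [← smul_left_cancel_iff g, ← hg, smul_algebraMap]
  obtain ⟨g, rfl⟩ := Algebra.IsInvariant.exists_smul_of_under_eq A B G M M'
    (hMunder.trans (hunder M').symm)
  have hyM' := hy0 g hne
  rw [hya] at hyM'
  have ha0 : a ∈ IsLocalRing.maximalIdeal A := by rw [← hunder (g • M)]; exact hyM'
  exact (IsLocalRing.maximalIdeal.isMaximal A).ne_top
    ((Ideal.eq_top_iff_one _).2 (by simpa using Ideal.sub_mem _ ha0 ha1))

open Polynomial in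
-- The leading coefficient times x is integral, hence equal to some d ∈ B. If d or the leading
-- coefficient is a unit, the claim follows at once; otherwise the degree can be lowered.
theorem isIntegral_or_isIntegral_inv_of_isUnit_coeff {B F : Type*} [CommRing B] [IsLocalRing B]
    [Field F] [Algebra B F] [IsIntegrallyClosedIn B F] {x : F} :
    ∀ (n : ℕ) (f : B[X]), f.natDegree ≤ n → aeval x f = 0 → (∃ k, IsUnit (f.coeff k)) →
      IsIntegral B x ∨ IsIntegral B x⁻¹ := by
  intro n
  induction n with
  | zero =>
    rintro f hf hx ⟨k, hk⟩
    rw [eq_C_of_natDegree_le_zero hf] at hx hk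
    rcases k with _ | k
    · rw [coeff_C_zero] at hk
      rw [aeval_C] at hx
      exact absurd hx (hk.map (algebraMap B F)).ne_zero
    · rw [coeff_C_succ] at hk
      exact absurd hk not_isUnit_zero
  | succ n ih =>
    rintro f hf hx ⟨k, hk⟩
    obtain ⟨d, hd⟩ : ∃ d : B, algebraMap B F d = f.coeff (n + 1) • x := by
      rcases eq_or_ne (f.coeff (n + 1)) 0 with h0 | h0
      · exact ⟨0, by simp [h0]⟩
      · refine IsIntegrallyClosedIn.algebraMap_eq_of_integral ?_
        have hdeg : f.natDegree = n + 1 := le_antisymm hf (le_natDegree_of_ne_zero h0)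
        have := isIntegral_leadingCoeff_smul f x hx
        rwa [leadingCoeff, hdeg] at this
    by_cases hdu : IsUnit d
    · right
      have hx0 : x ≠ 0 := by
        rintro rfl
        exact (hdu.map (algebraMap B F)).ne_zero (by simpa using hd)
      obtain ⟨u, rfl⟩ := hdu
      have : x⁻¹ = algebraMap B F (↑u⁻¹ * f.coeff (n + 1)) := by
        rw [inv_eq_iff_eq_inv, eq_comm, inv_eq_iff_eq_inv]
        refine eq_inv_of_mul_eq_one_left ?_
        rw [map_mul, mul_assoc, ← Algebra.smul_def (f.coeff _), ← hd, ← map_mul, Units.inv_mul,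
          map_one]
      rw [this]
      exact isIntegral_algebraMap
    by_cases hlu : IsUnit (f.coeff (n + 1))
    · left
      obtain ⟨u, hu⟩ := hlu
      have : x = algebraMap B F (↑u⁻¹ * d) := by
        rw [map_mul, hd, ← hu, ← Algebra.smul_def, smul_smul, Units.inv_mul, one_smul]
      rw [this]
      exact isIntegral_algebraMap
    -- The top term is absorbed as d x^n. Since neither d nor the leading coefficient is a unit,
    -- locality of B preserves a unit coefficient.
    refine ih (f - monomial (n + 1) (f.coeff (n + 1)) + monomial n d) ?_ ?_ ?_
    · rw [natDegree_le_iff_coeff_eq_zero]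
      intro N hN
      rcases eq_or_lt_of_le (Nat.succ_le_of_lt hN) with rfl | hN'
      · simp [coeff_monomial]
      · rw [coeff_add, coeff_sub, coeff_eq_zero_of_natDegree_lt (hf.trans_lt hN'),
          coeff_monomial, coeff_monomial, if_neg hN'.ne, if_neg hN.ne]
        simp
    · rw [map_add, map_sub, hx, aeval_monomial, aeval_monomial, hd, pow_succ', Algebra.smul_def]
      ring
    · refine ⟨k, ?_⟩
      have hkn : k ≠ n + 1 := by rintro rfl; exact hlu hk
      rw [coeff_add, coeff_sub, coeff_monomial, if_neg hkn.symm, sub_zero, coeff_monomial]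
      split_ifs with h
      · by_contra hcon
        refine (IsLocalRing.mem_maximalIdeal _).1 ?_ hk
        have := (IsLocalRing.maximalIdeal B).sub_mem ((IsLocalRing.mem_maximalIdeal _).2 hcon)
          ((IsLocalRing.mem_maximalIdeal _).2 hdu)
        simpa using this
      · simpa using hk

open Polynomial in
/-- Over a valuation ring, a nonzero polynomial over the fraction field can be rescaled so as to
have integral coefficients, one of which is a unit. -/
theorem exists_map_eq_C_mul_isUnit_coeff {A K : Type*} [CommRing A] [IsDomain A] [ValuationRing A]
    [Field K] [Algebra A K] [IsFractionRing A K] {q : K[X]} (hq : q ≠ 0) :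
    ∃ (f : A[X]) (c : K), f.map (algebraMap A K) = C c * q ∧ ∃ k, IsUnit (f.coeff k) := by
  obtain ⟨k, hk, hmax⟩ := Finset.exists_max_image q.support
    (fun i ↦ ValuationRing.valuation A K (q.coeff i)) (nonempty_support_iff.2 hq)
  have hk0 : q.coeff k ≠ 0 := mem_support_iff.1 hk
  have hv (i : ℕ) : ∃ a : A, algebraMap A K a = (q.coeff k)⁻¹ * q.coeff i := by
    rw [← ValuationRing.mem_integer_iff, Valuation.mem_integer_iff, map_mul, map_inv₀,
      inv_mul_le_one₀ ((Valuation.pos_iff _).2 hk0)]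
    by_cases hi : i ∈ q.support
    · exact hmax i hi
    · simp [notMem_support_iff.1 hi]
  obtain ⟨f, hf⟩ := (lifts_iff_coeff_lifts (f := algebraMap A K) (C (q.coeff k)⁻¹ * q)).2
    fun n ↦ by simpa using hv n
  refine ⟨f, _, hf, k, ?_⟩
  have : algebraMap A K (f.coeff k) = 1 := by
    have := congrArg (coeff · k) hf
    simpa [hk0] using this
  rw [← map_one (algebraMap A K)] at this
  rw [IsFractionRing.injective A K this]
  exact isUnit_one

theorem isIntegral_or_isIntegral_inv_of_finite (A K : Type*) {Ω : Type*}
    [CommRing A] [IsDomain A] [ValuationRing A] [HenselianLocalRing A]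
    [Field K] [Algebra A K] [IsFractionRing A K]
    [Field Ω] [Algebra K Ω] [Algebra A Ω] [IsScalarTower A K Ω] [IsGalois K Ω]
    [FiniteDimensional K Ω] (x : Ω) :
    IsIntegral A x ∨ IsIntegral A x⁻¹ := by
  have := integralClosure.isFractionRing_of_finite_extension (A := A) K Ω
  let := IsIntegralClosure.MulSemiringAction A K Ω (integralClosure A Ω)
  have := Algebra.isInvariant_of_isGalois A K Ω (integralClosure A Ω)
  have : SMulCommClass Gal(Ω/K) A (integralClosure A Ω) :=
    ⟨fun g a b ↦ map_smul (galRestrict A K Ω (integralClosure A Ω) g) a b⟩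
  have : IsLocalRing (integralClosure A Ω) :=
    isLocalRing_of_isInvariant A (integralClosure A Ω) Gal(Ω/K)
  obtain ⟨f, c, hf, k, hk⟩ := exists_map_eq_C_mul_isUnit_coeff (A := A)
    (minpoly.ne_zero (Algebra.IsIntegral.isIntegral (R := K) x))
  refine (isIntegral_or_isIntegral_inv_of_isUnit_coeff (x := x) _
    (f.map (algebraMap A (integralClosure A Ω))) le_rfl ?_ ⟨k, ?_⟩).imp
      (isIntegral_trans _) (isIntegral_trans _)
  · rw [Polynomial.aeval_map_algebraMap, ← Polynomial.aeval_map_algebraMap K, hf]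
    simp
  · rw [Polynomial.coeff_map]
    exact hk.map _

theorem isIntegral_or_isIntegral_inv (A K : Type*) {Ω : Type*}
    [CommRing A] [IsDomain A] [ValuationRing A] [HenselianLocalRing A]
    [Field K] [Algebra A K] [IsFractionRing A K]
    [Field Ω] [Algebra K Ω] [Algebra A Ω] [IsScalarTower A K Ω] [IsGalois K Ω]
    (x : Ω) : IsIntegral A x ∨ IsIntegral A x⁻¹ := by
  let E := FiniteGaloisIntermediateField.adjoin K ({x} : Set Ω)
  have hx : x ∈ E.toIntermediateField := FiniteGaloisIntermediateField.subset_adjoin K {x} rfl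
  have hE (z : E) : IsIntegral A (z : Ω) ↔ IsIntegral A z :=
    isIntegral_algHom_iff (E.val.restrictScalars A) Subtype.val_injective
  exact (isIntegral_or_isIntegral_inv_of_finite A K (⟨x, hx⟩ : E)).imp (hE _).2 (hE _).2

/-! ### The Galois-invariant valuation. -/

/-- The elements of a Galois extension which are integral over a Henselian valuation ring form a
valuation subring. -/
def integralValuationSubring (A K : Type*) (Ω : Type*) [CommRing A] [IsDomain A] [ValuationRing A]
    [HenselianLocalRing A] [Field K] [Algebra A K] [IsFractionRing A K]
    [Field Ω] [Algebra K Ω] [Algebra A Ω] [IsScalarTower A K Ω] [IsGalois K Ω] :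
    ValuationSubring Ω where
  toSubring := (integralClosure A Ω).toSubring
  mem_or_inv_mem' := isIntegral_or_isIntegral_inv A K

theorem valuation_le_one_iff_isIntegral (A K : Type*) {Ω : Type*}
    [CommRing A] [IsDomain A] [ValuationRing A] [HenselianLocalRing A]
    [Field K] [Algebra A K] [IsFractionRing A K]
    [Field Ω] [Algebra K Ω] [Algebra A Ω] [IsScalarTower A K Ω] [IsGalois K Ω]
    {x : Ω} :
    (integralValuationSubring A K Ω).valuation x ≤ 1 ↔ IsIntegral A x :=
  ValuationSubring.valuation_le_one_iff _ _

theorem valuation_le_iff_isIntegral_div (A K : Type*) {Ω : Type*}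
    [CommRing A] [IsDomain A] [ValuationRing A] [HenselianLocalRing A]
    [Field K] [Algebra A K] [IsFractionRing A K]
    [Field Ω] [Algebra K Ω] [Algebra A Ω] [IsScalarTower A K Ω] [IsGalois K Ω]
    {x y : Ω} (hy : y ≠ 0) :
    (integralValuationSubring A K Ω).valuation x ≤ (integralValuationSubring A K Ω).valuation y ↔
      IsIntegral A (x / y) := by
  rw [← valuation_le_one_iff_isIntegral A K, map_div₀, div_le_one₀ (by simpa [zero_lt_iff] using hy)]

theorem valuation_algEquiv_le (A K : Type*) {Ω : Type*}
    [CommRing A] [IsDomain A] [ValuationRing A] [HenselianLocalRing A]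
    [Field K] [Algebra A K] [IsFractionRing A K]
    [Field Ω] [Algebra K Ω] [Algebra A Ω] [IsScalarTower A K Ω] [IsGalois K Ω]
    (τ : Gal(Ω/K)) {x y : Ω}
    (h : (integralValuationSubring A K Ω).valuation x ≤
      (integralValuationSubring A K Ω).valuation y) :
    (integralValuationSubring A K Ω).valuation (τ x) ≤
      (integralValuationSubring A K Ω).valuation (τ y) := by
  rcases eq_or_ne y 0 with rfl | hy
  · rw [map_zero, le_zero_iff, map_eq_zero] at h
    simp [h]
  · rw [valuation_le_iff_isIntegral_div A K hy] at h
    rw [valuation_le_iff_isIntegral_div A K (by simpa using hy), ← map_div₀]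
    exact h.map (τ.toAlgHom.restrictScalars A)

/-- If τ raised the value of x, the values of τ^n x would never decrease in n; but the orbit of x is
finite, so some positive iterate returns to x. -/
theorem valuation_algEquiv (A K : Type*) {Ω : Type*}
    [CommRing A] [IsDomain A] [ValuationRing A] [HenselianLocalRing A]
    [Field K] [Algebra A K] [IsFractionRing A K]
    [Field Ω] [Algebra K Ω] [Algebra A Ω] [IsScalarTower A K Ω] [IsGalois K Ω]
    (τ : Gal(Ω/K)) (x : Ω) :
    (integralValuationSubring A K Ω).valuation (τ x) =
      (integralValuationSubring A K Ω).valuation x := by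
  suffices H : ∀ (τ : Gal(Ω/K)) (x : Ω), (integralValuationSubring A K Ω).valuation (τ x) ≤
      (integralValuationSubring A K Ω).valuation x from
    le_antisymm (H τ x) (by simpa using H τ⁻¹ (τ x))
  intro τ x
  by_contra! hlt
  have hmono : Monotone fun n : ℕ ↦ (integralValuationSubring A K Ω).valuation ((τ ^ n) x) := by
    refine monotone_nat_of_le_succ fun n ↦ ?_
    induction n with
    | zero => simpa using hlt.le
    | succ n ih => simpa only [pow_succ' τ, AlgEquiv.mul_apply] using valuation_algEquiv_le A K τ ih
  obtain ⟨m, n, hmn, h⟩ := Set.Finite.exists_lt_map_eq_of_forall_mem (t := (minpoly K x).rootSet Ω)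
    (f := fun n : ℕ ↦ (τ ^ n) x) (fun n ↦
      (isConjRoot_iff_mem_minpoly_rootSet (Algebra.IsIntegral.isIntegral x)).1
        (isConjRoot_of_algEquiv x _)) (Polynomial.rootSet_finite _ _)
  have hper : (τ ^ (n - m)) x = x := by
    refine (τ ^ m).injective ?_
    rw [← AlgEquiv.mul_apply, ← pow_add, Nat.add_sub_cancel' hmn.le]
    exact h.symm
  have := hmono (show 1 ≤ n - m by omega)
  simp only [hper, pow_one] at this
  exact this.not_gt hlt

theorem IsConjRoot.valuation_eq (A K : Type*) {Ω : Type*}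
    [CommRing A] [IsDomain A] [ValuationRing A] [HenselianLocalRing A]
    [Field K] [Algebra A K] [IsFractionRing A K]
    [Field Ω] [Algebra K Ω] [Algebra A Ω] [IsScalarTower A K Ω] [IsGalois K Ω]
    {x y : Ω} (h : IsConjRoot K x y) :
    (integralValuationSubring A K Ω).valuation x =
      (integralValuationSubring A K Ω).valuation y := by
  obtain ⟨τ, rfl⟩ := h.exists_algEquiv
  exact valuation_algEquiv A K τ y

/-! ### Basic Artin–Schreier theory. -/

theorem mem_range_algebraMap_of_pow_eq_self (p : ℕ) [Fact p.Prime] {K L : Type*} [Field K]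
    [CharP K p] [Field L] [Algebra K L] {x : L} (hx : x ^ p = x) :
    x ∈ Set.range (algebraMap K L) := by
  have : CharP L p := charP_of_injective_algebraMap (algebraMap K L).injective p
  have h := (Subfield.mem_bot_iff_pow_eq_self L p).2 hx
  exact (bot_le : ⊥ ≤ (algebraMap K L).fieldRange) h

theorem isIntegral_of_pow_eq_self {A L : Type*} [CommRing A] [Nontrivial A] [CommRing L]
    [Algebra A L] {p : ℕ}
    (hp : 1 < p) {x : L} (hx : x ^ p = x) : IsIntegral A x :=
  ⟨Polynomial.X ^ p - Polynomial.X, Polynomial.monic_X_pow_sub (by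
    rw [Polynomial.degree_X]; exact_mod_cast hp), by simp [hx]⟩

theorem pow_sub_self_sub_eq_self {p : ℕ} [Fact p.Prime] {L : Type*} [CommRing L] [CharP L p]
    {x y : L} (h : x ^ p - x = y ^ p - y) : (x - y) ^ p = x - y := by
  rw [sub_pow_char]
  linear_combination h

namespace ArtinSchreierGenerates

variable {p : ℕ} [Fact p.Prime] {K L : Type*} [Field K] [Field L] [Algebra K L]

open Polynomial

theorem monic_poly (h : K) : (X ^ p - X - C h).Monic := by
  have hp := (Fact.out : p.Prime).one_lt
  rw [sub_sub]
  refine monic_X_pow_sub ?_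
  rw [degree_X_add_C]
  exact_mod_cast hp

theorem natDegree_poly (h : K) : (X ^ p - X - C h).natDegree = p := by
  have hp := (Fact.out : p.Prime).one_lt
  rw [sub_sub, natDegree_sub_eq_left_of_natDegree_lt] <;> simp [hp]

theorem isIntegral {h : K} {α : L} (hα : α ^ p - α = algebraMap K L h) : IsIntegral K α :=
  ⟨_, monic_poly (p := p) h, by simp [hα]⟩

theorem adjoin_eq_top {h : K} {α : L} (hα : α ^ p - α = algebraMap K L h) (htop : K⟮α⟯ = ⊤) :
    Algebra.adjoin K {α} = ⊤ := by
  rw [← IntermediateField.adjoin_simple_toSubalgebra_of_isAlgebraic (isIntegral hα).isAlgebraic, htop,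
    IntermediateField.top_toSubalgebra]

variable [CharP K p]

theorem isSplittingField {h : K} (hh : ArtinSchreierGenerates p K L h) :
    (X ^ p - X - C h).IsSplittingField K L := by
  obtain ⟨α, hα, htop⟩ := hh
  have : CharP L p := charP_of_injective_algebraMap (algebraMap K L).injective p
  constructor
  · have hs : (X ^ p - X : L[X]).Splits := by
      simpa using (Subfield.splits_bot L p).map (Subfield.subtype _)
    have key : (X ^ p - X - C h : K[X]).map (algebraMap K L) = (X ^ p - X : L[X]).comp (X - C α) := by
      simp only [Polynomial.map_sub, Polynomial.map_pow, map_X, map_C, ← hα, sub_comp, pow_comp,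
        X_comp, sub_pow_char, map_sub, map_pow]
      ring
    rw [key]
    exact hs.comp_X_sub_C α
  · refine top_unique ((adjoin_eq_top hα htop).ge.trans (Algebra.adjoin_mono ?_))
    rw [Set.singleton_subset_iff, mem_rootSet]
    exact ⟨(monic_poly h).ne_zero, by simp [hα]⟩

theorem isGalois {h : K} (hh : ArtinSchreierGenerates p K L h) : IsGalois K L := by
  have := hh.isSplittingField
  -- The derivative is −1, so the Bézout relation is explicit.
  refine IsGalois.of_separable_splitting_field (p := X ^ p - X - C h) ⟨0, -1, ?_⟩
  simp [derivative_X_pow]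

theorem finiteDimensional {h : K} (hh : ArtinSchreierGenerates p K L h) :
    FiniteDimensional K L :=
  have := hh.isSplittingField
  IsSplittingField.finiteDimensional L (X ^ p - X - C h)

/-- A generator of the Galois group translates an Artin–Schreier generator by a nonzero element of
the prime field. -/
theorem exists_apply_eq_add {h : K} (hne : (⊥ : IntermediateField K L) ≠ ⊤) {α : L}
    (hα : α ^ p - α = algebraMap K L h) (htop : K⟮α⟯ = ⊤) {σ : Gal(L/K)}
    (hσ : Subgroup.zpowers σ = ⊤) :
    ∃ i : L, i ≠ 0 ∧ i ^ p = i ∧ σ α = α + i := by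
  have : CharP L p := charP_of_injective_algebraMap (algebraMap K L).injective p
  have := isGalois ⟨α, hα, htop⟩
  have := finiteDimensional ⟨α, hα, htop⟩
  refine ⟨σ α - α, fun h0 ↦ hne ?_, pow_sub_self_sub_eq_self ?_, by ring⟩
  · have hσ1 : σ = 1 := by
      have : (σ : L →ₐ[K] L) = AlgHom.id K L :=
        AlgHom.ext_of_adjoin_eq_top (adjoin_eq_top hα htop) (by simpa [sub_eq_zero] using h0)
      ext x
      exact DFunLike.congr_fun this x
    rw [hσ1, Subgroup.zpowers_one_eq_bot] at hσ
    have h1 := IsGalois.fixedField_top (F := K) (E := L)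
    rw [← hσ, IntermediateField.fixedField_bot] at h1
    exact h1.symm
  · rw [← map_pow, ← map_sub, hα, AlgEquiv.commutes]

theorem finrank_eq {h : K} (hh : ArtinSchreierGenerates p K L h)
    (hne : (⊥ : IntermediateField K L) ≠ ⊤) {σ : Gal(L/K)} (hσ : Subgroup.zpowers σ = ⊤) :
    Module.finrank K L = p := by
  have := hh.isGalois
  have := hh.finiteDimensional
  have : CharP L p := charP_of_injective_algebraMap (algebraMap K L).injective p
  obtain ⟨α, hα, htop⟩ := hh
  obtain ⟨i, hi0, hi, hσi⟩ := exists_apply_eq_add hne hα htop hσ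
  obtain ⟨j, rfl⟩ := mem_range_algebraMap_of_pow_eq_self p (K := K) hi
  have hpow (n : ℕ) : (σ ^ n) α = α + n * algebraMap K L j := by
    induction n with
    | zero => simp
    | succ n ih =>
      rw [pow_succ', AlgEquiv.mul_apply, ih, map_add, map_mul, map_natCast, AlgEquiv.commutes, hσi]
      push_cast
      ring
  rw [← IsGalois.card_aut_eq_finrank, ← Nat.card_congr Subgroup.topEquiv.toEquiv, ← hσ,
    Nat.card_zpowers]
  refine orderOf_eq_prime ?_ ?_
  · have : ((σ ^ p : Gal(L/K)) : L →ₐ[K] L) = AlgHom.id K L :=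
      AlgHom.ext_of_adjoin_eq_top (adjoin_eq_top hα htop) (by
        rw [Set.eqOn_singleton]
        exact (hpow p).trans (by simp))
    ext x
    exact DFunLike.congr_fun this x
  · rintro rfl
    exact hi0 (by simpa using hσi)

theorem norm_eq (hdim : Module.finrank K L = p) {h : K} {α : L}
    (hα : α ^ p - α = algebraMap K L h) (htop : K⟮α⟯ = ⊤) : Algebra.norm K α = h := by
  have := finiteDimensional ⟨α, hα, htop⟩
  have hmin : minpoly K α = X ^ p - X - C h := by
    refine (eq_of_monic_of_dvd_of_natDegree_le (minpoly.monic (isIntegral hα)) (monic_poly h)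
      (minpoly.dvd _ _ (by simp [hα])) ?_).symm
    rw [natDegree_poly, (Field.primitive_element_iff_minpoly_natDegree_eq K α).1 htop, hdim]
  let pb := PowerBasis.ofAdjoinEqTop (isIntegral hα) (adjoin_eq_top hα htop)
  have hgen : pb.gen = α := PowerBasis.ofAdjoinEqTop_gen _ _
  have hpd : pb.dim = p := by rw [← pb.finrank, hdim]
  have hp0 : p ≠ 0 := (Fact.out : p.Prime).ne_zero
  have := Algebra.PowerBasis.norm_gen_eq_coeff_zero_minpoly pb
  rw [hgen, hpd, hmin] at this
  rw [this]
  -- The norm is (−1)^p times the constant coefficient −h; the sign identity also covers p = 2.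
  have hneg : (-1 : K) ^ p = -1 := neg_one_pow_char K p
  simp [hneg, coeff_X_pow, hp0.symm]

theorem sub_algebraMap {h : K} {α : L} (hα : α ^ p - α = algebraMap K L h) (htop : K⟮α⟯ = ⊤)
    (k : K) : (α - algebraMap K L k) ^ p - (α - algebraMap K L k) =
      algebraMap K L (h - (k ^ p - k)) ∧ K⟮α - algebraMap K L k⟯ = ⊤ := by
  have : CharP L p := charP_of_injective_algebraMap (algebraMap K L).injective p
  refine ⟨?_, ?_⟩
  · rw [sub_pow_char]
    simp only [map_sub, map_pow]
    linear_combination hα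
  · refine top_unique (htop.ge.trans ?_)
    rw [IntermediateField.adjoin_simple_le_iff]
    simpa using add_mem (IntermediateField.mem_adjoin_simple_self K (α - algebraMap K L k))
      (IntermediateField.algebraMap_mem _ k)

end ArtinSchreierGenerates

/-! ### Polynomials of degree below p and approximation from K. -/

open Polynomial UniqueFactorizationMonoid in
/-- A polynomial of degree less than the characteristic splits over a separably closed field. -/
theorem splits_of_natDegree_lt_char {p : ℕ} [Fact p.Prime] {F : Type*} [Field F] [CharP F p]
    [IsSepClosed F] {f : F[X]} (hf : f.natDegree < p) : f.Splits := by
  rcases eq_or_ne f 0 with rfl | h0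
  · exact Splits.zero
  have hirr (q : F[X]) (hq : Irreducible q) (hqf : q ∣ f) : q.degree = 1 := by
    refine IsSepClosed.degree_eq_one_of_irreducible F hq ((separable_iff_derivative_ne_zero hq).2 ?_)
    intro hder
    have hqd : q.natDegree < p := (natDegree_le_of_dvd hqf h0).trans_lt hf
    -- Coefficient d of the derivative is d + 1 times the leading coefficient, and 0 < d + 1 < p.
    obtain ⟨d, hd⟩ := Nat.exists_eq_succ_of_ne_zero hq.natDegree_pos.ne'
    have h := congrArg (coeff · d) hder
    simp only [coeff_derivative, coeff_zero, mul_eq_zero] at h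
    rcases h with h | h
    · rw [← Nat.succ_eq_add_one, ← hd, coeff_natDegree, leadingCoeff_eq_zero] at h
      exact hq.ne_zero h
    · have h' : ((d + 1 : ℕ) : F) = 0 := by exact_mod_cast h
      rw [CharP.cast_eq_zero_iff F p] at h'
      exact absurd (Nat.le_of_dvd d.succ_pos h') (by omega)
  obtain ⟨u, hu⟩ := factors_prod h0
  rw [← hu]
  refine (Splits.multisetProd fun g hg ↦ ?_).mul u.isUnit.splits
  exact Splits.of_degree_eq_one (hirr g (irreducible_of_factor g hg) (dvd_of_mem_factors hg))

/-- The degree of r over K divides [L(r) : K], which is [L : K] times its degree over L.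
Consequently the K-conjugates of r are already L-conjugates. -/
theorem minpoly_map_of_natDegree_coprime_finrank {K L Ω : Type*} [Field K] [Field L] [Field Ω]
    [Algebra K L] [Algebra K Ω] [Algebra L Ω] [IsScalarTower K L Ω] [FiniteDimensional K L] {r : Ω}
    (hr : IsIntegral K r) (hco : (minpoly K r).natDegree.Coprime (Module.finrank K L)) :
    (minpoly K r).map (algebraMap K L) = minpoly L r := by
  have hrL : IsIntegral L r := hr.tower_top
  refine Polynomial.eq_of_monic_of_dvd_of_natDegree_le (minpoly.monic hrL)
    ((minpoly.monic hr).map _) (minpoly.dvd_map_of_isScalarTower K L r) ?_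
  rw [Polynomial.natDegree_map]
  refine Nat.le_of_dvd (minpoly.natDegree_pos hrL) (hco.dvd_of_dvd_mul_left ?_)
  have : FiniteDimensional L L⟮r⟯ := IntermediateField.adjoin.finiteDimensional hrL
  have : FiniteDimensional K L⟮r⟯ := FiniteDimensional.trans K L L⟮r⟯
  have : IsScalarTower K L⟮r⟯ Ω := .of_algebraMap_eq fun x ↦ by
    rw [IsScalarTower.algebraMap_apply K L Ω, IsScalarTower.algebraMap_apply K L L⟮r⟯,
      ← IsScalarTower.algebraMap_apply L L⟮r⟯ Ω]
  have hgen : minpoly K (IntermediateField.AdjoinSimple.gen L r) = minpoly K r :=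
    (minpoly.algebraMap_eq (algebraMap L⟮r⟯ Ω).injective
      (IntermediateField.AdjoinSimple.gen L r)).symm
  rw [← hgen, ← IntermediateField.adjoin.finrank hrL, Module.finrank_mul_finrank]
  exact minpoly.degree_dvd (IsIntegral.of_finite _ _)

theorem Valuation.map_card_nsmul_sub_sum_le {R Γ : Type*} [CommRing R]
    [LinearOrderedCommGroupWithZero Γ] (v : Valuation R Γ) (x : R) (γ : Γ) (s : Multiset R)
    (h : ∀ y ∈ s, v (x - y) ≤ γ) : v (s.card * x - s.sum) ≤ γ := by
  induction s using Multiset.induction_on with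
  | empty => simp
  | cons y s ih =>
    have : (((y ::ₘ s).card : ℕ) : R) * x - (y ::ₘ s).sum = (x - y) + (s.card * x - s.sum) := by
      rw [Multiset.card_cons, Multiset.sum_cons]
      push_cast
      ring
    rw [this]
    exact v.map_add_le (h y (Multiset.mem_cons_self y s))
      (ih fun z hz ↦ h z (Multiset.mem_cons_of_mem hz))

section

variable {p : ℕ} [Fact p.Prime] (A K : Type*) {L Ω : Type*} [CommRing A] [IsDomain A]
    [ValuationRing A] [HenselianLocalRing A] [Field K] [Algebra A K] [IsFractionRing A K]
    [CharP K p] [Field L] [Algebra K L] [Field Ω] [Algebra K Ω] [Algebra L Ω] [Algebra A Ω]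
    [IsScalarTower A K Ω] [IsScalarTower K L Ω] [IsGalois K Ω]

open Polynomial in
-- All K-conjugates of r are conjugate over L, hence equally far from α ∈ L. Their mean lies in K,
-- and the ultrametric inequality bounds its distance to α because their number, being prime to p,
-- is a unit.
theorem exists_valuation_sub_algebraMap_le (hdim : Module.finrank K L = p) (α : L) {r : Ω}
    (hr : (minpoly K r).natDegree < p) :
    ∃ k : K, (integralValuationSubring A K Ω).valuation (algebraMap L Ω α - algebraMap K Ω k) ≤
      (integralValuationSubring A K Ω).valuation (algebraMap L Ω α - r) := by
  have hp : p.Prime := Fact.out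
  have : FiniteDimensional K L := .of_finrank_pos (by rw [hdim]; exact hp.pos)
  have : CharP Ω p := charP_of_injective_algebraMap (algebraMap K Ω).injective p
  have hrK : IsIntegral K r := Algebra.IsIntegral.isIntegral r
  set q := minpoly K r with hq
  have hqm : q.Monic := minpoly.monic hrK
  have hq0 : 0 < q.natDegree := minpoly.natDegree_pos hrK
  have hmap : q.map (algebraMap K L) = minpoly L r :=
    minpoly_map_of_natDegree_coprime_finrank hrK
      (by rw [hdim]; exact (hp.coprime_iff_not_dvd.2 fun h ↦ (Nat.le_of_dvd hq0 h).not_gt hr).symm)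
  have hsplit : (q.map (algebraMap K Ω)).Splits := IsGalois.splits K r
  have hcard : (q.map (algebraMap K Ω)).roots.card = q.natDegree := by
    rw [← hsplit.natDegree_eq_card_roots, natDegree_map]
  have hm0 : (q.natDegree : Ω) ≠ 0 := by
    rw [Ne, CharP.cast_eq_zero_iff Ω p]
    exact fun h ↦ (Nat.le_of_dvd hq0 h).not_gt hr
  have hsum := (integralValuationSubring A K Ω).valuation.map_card_nsmul_sub_sum_le
    (algebraMap L Ω α) _ (q.map (algebraMap K Ω)).roots fun y hy ↦ le_of_eq (b :=
      (integralValuationSubring A K Ω).valuation (algebraMap L Ω α - r)) <| by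
    have h1 : IsConjRoot L r y := by
      rw [isConjRoot_iff_aeval_eq_zero hrK.tower_top, ← hmap, aeval_map_algebraMap, aeval_def,
        ← eval_map]
      exact isRoot_of_mem_roots hy
    have h2 := (h1.sub_algebraMap α).neg
    rw [neg_sub, neg_sub] at h2
    exact (h2.of_isScalarTower (Algebra.IsIntegral.isIntegral _)).symm.valuation_eq A K
  -- The mean of the conjugates, read off the next-to-leading coefficient.
  refine ⟨-(q.nextCoeff / q.natDegree), le_trans ?_ hsum⟩
  have hnext := hsplit.nextCoeff_eq_neg_sum_roots_of_monic (hqm.map _)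
  rw [nextCoeff_map (algebraMap K Ω).injective] at hnext
  have heq : algebraMap L Ω α - algebraMap K Ω (-(q.nextCoeff / q.natDegree)) =
      (q.natDegree : Ω)⁻¹ * (q.natDegree * algebraMap L Ω α -
        (q.map (algebraMap K Ω)).roots.sum) := by
    rw [map_neg, map_div₀, map_natCast, hnext]
    field_simp
  rw [heq, hcard, map_mul]
  refine mul_le_of_le_one_left' ?_
  rw [valuation_le_one_iff_isIntegral]
  refine isIntegral_of_pow_eq_self hp.one_lt ?_
  rw [inv_pow, ← frobenius_def, map_natCast]

/-! ### Domination by inverses of translates. -/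

/-- `y` is bounded by the inverse of some `K`-translate of `α`. -/
def DominatedByTranslate (α y : Ω) : Prop :=
  ∃ k : K, (integralValuationSubring A K Ω).valuation (y * (α - algebraMap K Ω k)) ≤ 1

variable {A K}

/-- Whichever of the two translates has the smaller value works for both summands. -/
theorem DominatedByTranslate.add {α y z : Ω} (hy : DominatedByTranslate A K α y)
    (hz : DominatedByTranslate A K α z) : DominatedByTranslate A K α (y + z) := by
  obtain ⟨k, hk⟩ := hy
  obtain ⟨l, hl⟩ := hz
  set v := (integralValuationSubring A K Ω).valuation
  rcases le_total (v (α - algebraMap K Ω k)) (v (α - algebraMap K Ω l)) with h | h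
  · refine ⟨k, ?_⟩
    rw [add_mul]
    refine v.map_add_le hk (le_trans ?_ hl)
    rw [map_mul, map_mul]
    gcongr
  · refine ⟨l, ?_⟩
    rw [add_mul]
    refine v.map_add_le (le_trans ?_ hk) hl
    rw [map_mul, map_mul]
    gcongr

theorem DominatedByTranslate.mul {α y c : Ω} (hy : DominatedByTranslate A K α y)
    (hc : (integralValuationSubring A K Ω).valuation c ≤ 1) :
    DominatedByTranslate A K α (c * y) := by
  obtain ⟨k, hk⟩ := hy
  refine ⟨k, ?_⟩
  rw [mul_assoc, map_mul]
  exact mul_le_one' hc hk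

theorem DominatedByTranslate.zero (α : Ω) : DominatedByTranslate A K α 0 := ⟨0, by simp⟩

theorem DominatedByTranslate.valuation_le_one {α y : Ω} (hy : DominatedByTranslate A K α y)
    (hα : ∀ k : K, 1 ≤ (integralValuationSubring A K Ω).valuation (α - algebraMap K Ω k)) :
    (integralValuationSubring A K Ω).valuation y ≤ 1 := by
  obtain ⟨k, hk⟩ := hy
  rw [map_mul] at hk
  exact (le_mul_of_one_le_right' (hα k)).trans hk

/-- Induction on (1 + y)P − 1 = y + (P − 1) + y(P − 1), where `hα` makes y integral and so controls
the last term. -/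
theorem DominatedByTranslate.prod_one_add_sub_one {α : Ω}
    (hα : ∀ k : K, 1 ≤ (integralValuationSubring A K Ω).valuation (α - algebraMap K Ω k))
    (s : Multiset Ω) (hs : ∀ y ∈ s, DominatedByTranslate A K α y) :
    DominatedByTranslate A K α ((s.map (1 + ·)).prod - 1) := by
  induction s using Multiset.induction_on with
  | empty => simpa using DominatedByTranslate.zero α
  | cons y s ih =>
    have hy := hs y (Multiset.mem_cons_self y s)
    have ih := ih fun z hz ↦ hs z (Multiset.mem_cons_of_mem hz)
    rw [Multiset.map_cons, Multiset.prod_cons]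
    have : (1 + y) * (s.map (1 + ·)).prod - 1 =
        y + ((s.map (1 + ·)).prod - 1) + y * ((s.map (1 + ·)).prod - 1) := by ring
    rw [this]
    exact (hy.add ih).add (ih.mul (hy.valuation_le_one hα))

open Polynomial in
-- Factoring g over Ω turns the quotient into ∏ (1 + i/(α − r)). Each root r has degree below p over
-- K, so some k ∈ K is at least as close to α.
theorem DominatedByTranslate.aeval_div_aeval_sub_one [IsSepClosed Ω]
    (hdim : Module.finrank K L = p) {α : L}
    (hα : ∀ k : K, 1 ≤ (integralValuationSubring A K Ω).valuation
      (algebraMap L Ω α - algebraMap K Ω k))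
    {i : Ω} (hi : i ^ p = i) {g : K[X]} (hg : g.natDegree < p)
    (hg0 : aeval (algebraMap L Ω α) g ≠ 0) :
    DominatedByTranslate A K (algebraMap L Ω α)
      (aeval (algebraMap L Ω α + i) g / aeval (algebraMap L Ω α) g - 1) := by
  have : CharP Ω p := charP_of_injective_algebraMap (algebraMap K Ω).injective p
  have hgne : g ≠ 0 := by rintro rfl; simp at hg0
  have hsplit : (g.map (algebraMap K Ω)).Splits :=
    splits_of_natDegree_lt_char (p := p) (by rwa [natDegree_map])
  have heval (x : Ω) : aeval x g = algebraMap K Ω g.leadingCoeff *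
      ((g.map (algebraMap K Ω)).roots.map (x - ·)).prod := by
    rw [aeval_def, ← eval_map, hsplit.eval_eq_prod_roots, leadingCoeff_map]
  have hne (r : Ω) (hr : r ∈ (g.map (algebraMap K Ω)).roots) : algebraMap L Ω α - r ≠ 0 := by
    intro h
    refine hg0 ?_
    rw [heval, Multiset.prod_eq_zero (Multiset.mem_map.2 ⟨r, hr, h⟩), mul_zero]
  have hprod : aeval (algebraMap L Ω α + i) g / aeval (algebraMap L Ω α) g =
      (((g.map (algebraMap K Ω)).roots.map fun r ↦ i / (algebraMap L Ω α - r)).map (1 + ·)).prod := by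
    rw [heval, heval, mul_div_mul_left _ _ (by simpa using hgne), ← Multiset.prod_map_div,
      Multiset.map_map]
    refine congrArg _ (Multiset.map_congr rfl fun r hr ↦ ?_)
    have := hne r hr
    simp only [Function.comp_apply]
    field_simp
    ring
  rw [hprod]
  refine prod_one_add_sub_one hα _ fun y hy ↦ ?_
  obtain ⟨r, hr, rfl⟩ := Multiset.mem_map.1 hy
  have hroot : aeval r g = 0 := by
    rw [aeval_def, ← eval_map]
    exact isRoot_of_mem_roots hr
  obtain ⟨k, hk⟩ := exists_valuation_sub_algebraMap_le (p := p) A K hdim α (r := r)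
    ((natDegree_le_of_dvd (minpoly.dvd K r hroot) hgne).trans_lt hg)
  have hiv : (integralValuationSubring A K Ω).valuation i ≤ 1 :=
    (valuation_le_one_iff_isIntegral A K).2
      (isIntegral_of_pow_eq_self (Fact.out : p.Prime).one_lt hi)
  refine ⟨k, ?_⟩
  rw [div_mul_eq_mul_div, mul_div_assoc, map_mul, map_div₀]
  exact mul_le_one' hiv (div_le_one_of_le₀ hk zero_le)

end

/-! ### Hensel's lemma and the size of generators. -/

open Polynomial in
-- For such a, T^p − T − a has the simple root 0 modulo the maximal ideal; a lift b ∈ A makes α − b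
-- an element of the prime field, collapsing L to K.
theorem ArtinSchreierGenerates.notMem_maximalIdeal {p : ℕ} [Fact p.Prime] {A K L : Type*}
    [CommRing A] [HenselianLocalRing A] [Field K] [Algebra A K] [CharP K p] [Field L] [Algebra K L]
    (hne : (⊥ : IntermediateField K L) ≠ ⊤) {a : A}
    (h : ArtinSchreierGenerates p K L (algebraMap A K a)) : a ∉ IsLocalRing.maximalIdeal A := by
  intro ha
  have hp := (Fact.out : p.Prime).one_lt
  have : CharP L p := charP_of_injective_algebraMap (algebraMap K L).injective p
  obtain ⟨α, hα, htop⟩ := h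
  have hmonic : (X ^ p - X - C a : A[X]).Monic := by
    rw [sub_sub]
    refine monic_X_pow_sub ?_
    rw [degree_X_add_C]
    exact_mod_cast hp
  obtain ⟨b, hb, -⟩ := HenselianLocalRing.is_henselian _ hmonic 0
    (by simpa [(zero_lt_one.trans hp).ne'] using ha)
    (by simp [derivative_X_pow, Nat.sub_ne_zero_of_lt hp])
  have hb' : b ^ p - b = a := by simpa [IsRoot.def, sub_eq_zero] using hb
  have hmem := mem_range_algebraMap_of_pow_eq_self p (K := K)
    (pow_sub_self_sub_eq_self (x := α) (y := algebraMap K L (algebraMap A K b)) (p := p) (by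
      rw [hα, ← hb']; simp only [map_sub, map_pow]))
  obtain ⟨k, hk⟩ := hmem
  refine hne (htop ▸ (IntermediateField.adjoin_simple_eq_bot_iff.2 ?_).symm)
  rw [IntermediateField.mem_bot]
  exact ⟨k + algebraMap A K b, by rw [map_add, hk]; ring⟩

section

variable {p : ℕ} [Fact p.Prime] {A K L Ω : Type*} [CommRing A] [IsDomain A]
    [ValuationRing A] [HenselianLocalRing A] [Field K] [Algebra A K] [IsFractionRing A K]
    [CharP K p] [Field L] [Algebra K L] [Field Ω] [Algebra K Ω] [Algebra L Ω] [Algebra A Ω]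
    [IsScalarTower A K Ω] [IsScalarTower K L Ω] [IsGalois K Ω]

theorem ArtinSchreierGenerates.isInteger_inv (hne : (⊥ : IntermediateField K L) ≠ ⊤) {h : K}
    (hh : ArtinSchreierGenerates p K L h) : ∃ a : A, algebraMap A K a = h⁻¹ := by
  obtain ⟨a, ha⟩ | h' := ValuationRing.isInteger_or_isInteger A h
  · rw [← ha] at hh ⊢
    have hu := IsLocalRing.notMem_maximalIdeal.1 (hh.notMem_maximalIdeal hne)
    obtain ⟨u, rfl⟩ := hu
    exact ⟨↑u⁻¹, by rw [eq_comm, inv_eq_iff_eq_inv, ← map_units_inv]; simp⟩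
  · exact h'

/-- If v(α) < 1, then v(h) = v(α^p − α) < 1, contradicting h⁻¹ ∈ A. -/
theorem ArtinSchreierGenerates.one_le_valuation (hne : (⊥ : IntermediateField K L) ≠ ⊤) {h : K}
    {α : L} (hα : α ^ p - α = algebraMap K L h) (htop : K⟮α⟯ = ⊤) :
    1 ≤ (integralValuationSubring A K Ω).valuation (algebraMap L Ω α) := by
  set v := (integralValuationSubring A K Ω).valuation
  by_contra! hlt
  have hp := (Fact.out : p.Prime)
  obtain ⟨a, ha⟩ := isInteger_inv (A := A) hne ⟨α, hα, htop⟩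
  have h0 : h ≠ 0 := by
    rintro rfl
    obtain ⟨k, hk⟩ := mem_range_algebraMap_of_pow_eq_self p (K := K) (x := α)
      (by simpa [sub_eq_zero] using hα)
    refine hne (htop ▸ (IntermediateField.adjoin_simple_eq_bot_iff.2 ?_).symm)
    rw [IntermediateField.mem_bot]
    exact ⟨k, hk⟩
  have h1 : v (algebraMap K Ω h) < 1 := by
    rw [IsScalarTower.algebraMap_apply K L Ω, ← hα, map_sub, map_pow]
    refine v.map_sub_lt ?_ hlt
    rw [map_pow]
    exact pow_lt_one' hlt hp.ne_zero
  have h2 : v (algebraMap K Ω h)⁻¹ ≤ 1 := by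
    rw [valuation_le_one_iff_isIntegral, ← map_inv₀, ← ha, ← IsScalarTower.algebraMap_apply]
    exact isIntegral_algebraMap
  rw [map_inv₀, inv_le_one₀ ((v.pos_iff).2 (by simpa using h0))] at h2
  exact h2.not_gt h1

theorem dominatedByTranslate_of_mem_lefschetzIdeal [Algebra A L] [IsScalarTower A K L]
    [IsScalarTower A L Ω] [IsSepClosed Ω]
    (hne : (⊥ : IntermediateField K L) ≠ ⊤) {h : K} {α : L}
    (hα : α ^ p - α = algebraMap K L h) (htop : K⟮α⟯ = ⊤) {σ : Gal(L/K)}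
    (hσ : Subgroup.zpowers σ = ⊤) {y : L} (hy : y ∈ lefschetzIdeal A σ) :
    DominatedByTranslate A K (algebraMap L Ω α) (algebraMap L Ω y) := by
  induction hy using Submodule.span_induction with
  | zero => simpa using DominatedByTranslate.zero _
  | add y z _ _ hy hz => rw [map_add]; exact hy.add hz
  | smul c y _ hy =>
    rw [Algebra.smul_def, map_mul]
    refine hy.mul ?_
    rw [valuation_le_one_iff_isIntegral]
    exact c.2.map (IsScalarTower.toAlgHom A L Ω)
  | mem y hy =>
    obtain ⟨b, hb, rfl⟩ := hy
    obtain ⟨i, -, hi, hσα⟩ := ArtinSchreierGenerates.exists_apply_eq_add hne hα htop hσ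
    have hdim := ArtinSchreierGenerates.finrank_eq ⟨α, hα, htop⟩ hne hσ
    let pb := PowerBasis.ofAdjoinEqTop (ArtinSchreierGenerates.isIntegral hα)
      (ArtinSchreierGenerates.adjoin_eq_top hα htop)
    -- The bound deg g < [L : K] = p is what makes the factorization over Ω and the averaging
    -- available.
    obtain ⟨g, hg, rfl⟩ := pb.exists_eq_aeval b
    rw [← pb.finrank, hdim] at hg
    have hgen : pb.gen = α := PowerBasis.ofAdjoinEqTop_gen _ _
    rw [hgen] at hb ⊢
    rw [← Polynomial.aeval_algHom_apply, hσα, map_sub, map_div₀, map_one,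
      ← Polynomial.aeval_algebraMap_apply, ← Polynomial.aeval_algebraMap_apply, map_add]
    refine DominatedByTranslate.aeval_div_aeval_sub_one hdim (fun k ↦ ?_)
      (by rw [← map_pow, hi]) hg ?_
    · obtain ⟨h1, h2⟩ := ArtinSchreierGenerates.sub_algebraMap hα htop k
      have := ArtinSchreierGenerates.one_le_valuation (A := A) (Ω := Ω) hne h1 h2
      rwa [map_sub, ← IsScalarTower.algebraMap_apply] at this
    · rw [Polynomial.aeval_algebraMap_apply]
      simpa using hb

end

/-! ### The main theorem. -/

/-- The submodules `𝓗 ⊆ K` and `J_σ ⊆ L` are ideals of `A` and of `B` (they lie in `A`, resp. `B`),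
and `𝓗` is generated by the norms of the elements of `J_σ`. -/
theorem theorem4p5 (p : ℕ) [Fact p.Prime]
    {A K L : Type*} [CommRing A] [IsDomain A] [ValuationRing A] [HenselianLocalRing A]
    (hA : ¬ IsField A)
    [Field K] [Algebra A K] [IsFractionRing A K] [CharP K p]
    [Field L] [Algebra K L] [Algebra A L] [IsScalarTower A K L]
    (hL : IsNontrivialArtinSchreier p K L)
    (σ : L ≃ₐ[K] L) (hσ : Subgroup.zpowers σ = ⊤) :
    artinSchreierIdeal p A K L ≤ (1 : Submodule A K) ∧
    lefschetzIdeal A σ ≤ (1 : Submodule (integralClosure A L) L) ∧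
    artinSchreierIdeal p A K L = normIdeal A K (lefschetzIdeal A σ) := by
  obtain ⟨⟨f, hf⟩, hne⟩ := hL
  have hdim := hf.finrank_eq hne hσ
  have := hf.finiteDimensional
  have := hf.isGalois
  have hp : p.Prime := Fact.out
  obtain ⟨α, hα, htop⟩ := hf
  let Ω := SeparableClosure K
  let φ : L →ₐ[K] Ω := IsSepClosed.lift
  let := φ.toRingHom.toAlgebra
  have : IsScalarTower K L Ω := .of_algebraMap_eq fun x ↦ (φ.commutes x).symm
  have : IsScalarTower A L Ω := .of_algebraMap_eq fun x ↦ by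
    rw [IsScalarTower.algebraMap_apply A K L, ← IsScalarTower.algebraMap_apply K L Ω,
      ← IsScalarTower.algebraMap_apply A K Ω]
  have hJ (y : L) (hy : y ∈ lefschetzIdeal A σ) :=
    dominatedByTranslate_of_mem_lefschetzIdeal (Ω := Ω) hne hα htop hσ hy
  have hint (y : L) : (integralValuationSubring A K Ω).valuation (algebraMap L Ω y) ≤ 1 ↔
      IsIntegral A y := by
    rw [valuation_le_one_iff_isIntegral]
    exact isIntegral_algHom_iff (IsScalarTower.toAlgHom A L Ω) (algebraMap L Ω).injective
  have hone (k : K) : 1 ≤ (integralValuationSubring A K Ω).valuation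
      (algebraMap L Ω (α - algebraMap K L k)) :=
    have h := ArtinSchreierGenerates.sub_algebraMap hα htop k
    ArtinSchreierGenerates.one_le_valuation hne h.1 h.2
  refine ⟨?_, fun y hy ↦ ?_, le_antisymm ?_ ?_⟩
  · refine Submodule.span_le.2 ?_
    rintro _ ⟨h, -, hh, rfl⟩
    obtain ⟨a, ha⟩ := hh.isInteger_inv (A := A) hne
    exact Submodule.mem_one.2 ⟨a, by rw [ha, one_div]⟩
  · have := (hJ y hy).valuation_le_one fun k ↦ by
      rw [IsScalarTower.algebraMap_apply K L Ω, ← map_sub]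
      exact hone k
    exact Submodule.mem_one.2 ⟨⟨y, (hint y).1 this⟩, rfl⟩
  · refine Submodule.span_le.2 ?_
    rintro _ ⟨h, h0, ⟨β, hβ, hβtop⟩, rfl⟩
    refine Submodule.subset_span ⟨β⁻¹, ?_, ?_⟩
    · obtain ⟨i, hi0, hi, hσβ⟩ := ArtinSchreierGenerates.exists_apply_eq_add hne hβ hβtop hσ
      have hβ0 : β ≠ 0 := by
        rintro rfl
        rw [zero_pow hp.ne_zero, sub_zero, eq_comm, map_eq_zero] at hβ
        exact h0 hβ
      have hiint : IsIntegral A i⁻¹ := isIntegral_of_pow_eq_self hp.one_lt (by rw [inv_pow, hi])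
      -- Here σβ/β − 1 = i/β.
      have heq : β⁻¹ = (⟨i⁻¹, hiint⟩ : integralClosure A L) • (σ β / β - 1) := by
        rw [Subalgebra.smul_def, smul_eq_mul, hσβ]
        field_simp
        ring
      rw [heq]
      exact Submodule.smul_mem _ _ (Submodule.subset_span ⟨β, hβ0, rfl⟩)
    · rw [Algebra.norm_inv, ArtinSchreierGenerates.norm_eq hdim hβ hβtop, one_div]
  · refine Submodule.span_le.2 ?_
    rintro _ ⟨y, hy, rfl⟩
    -- With c = y(α − k) integral, N(y) = N(c)/N(α − k), where N(c) ∈ A and N(α − k) is the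
    -- Artin–Schreier constant of the translate.
    obtain ⟨k, hk⟩ := hJ y hy
    rw [IsScalarTower.algebraMap_apply K L Ω, ← map_sub, ← map_mul, hint] at hk
    obtain ⟨h1, h2⟩ := ArtinSchreierGenerates.sub_algebraMap hα htop k
    have hnorm := ArtinSchreierGenerates.norm_eq hdim h1 h2
    have h0 : f - (k ^ p - k) ≠ 0 := by
      rw [← hnorm, Algebra.norm_ne_zero_iff]
      intro h
      have := hone k
      simp [h] at this
    obtain ⟨a, ha⟩ := IsIntegrallyClosed.isIntegral_iff.1 (Algebra.isIntegral_norm K hk)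
    have heq : Algebra.norm K y = a • (1 / (f - (k ^ p - k))) := by
      rw [Algebra.smul_def, ha, map_mul, hnorm]
      field_simp
    rw [heq]
    exact Submodule.smul_mem _ _ (Submodule.subset_span ⟨_, h0, ⟨_, h1, h2⟩, rfl⟩)
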